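/- For a finite simple graph $G$, let $\operatorname{tww}(G)$ denote its twin-width: the minimum $d$ such that $G$, regarded as a trigraph without red edges, can be reduced to a one-vertex trigraph by successively contracting pairs of distinct vertices so that in every trigraph of the sequence each vertex is incident with at most $d$ red edges. (A trigraph has disjoint sets of black and red edges. Contracting $u$ and $v$ replaces them by a new vertex $w$ and changes nothing among the other vertices; for every other vertex $x$, $wx$ is a black edge if both $ux$ and $vx$ are black edges, $wx$ is a non-edge if neither $ux$ nor $vx$ is an edge, and $wx$ is a red edge otherwise.) Let $G(n,p)$ denote the random graph on $n$ labelled vertices in which each pair of vertices is adjacent independently with probability $p$. There exist absolute constants $c, C > 0$ such that for every function $p\colon \mathbb{N} \to [0,1]$ with $$\frac{726 \ln n}{n} \le p(n) \le \frac12 \quad \text{for all sufficiently large } n,$$ one has, with $p = p(n)$, $$\lim_{n \to \infty} \Pr\bigl[\, c\, n\sqrt{p} \le \operatorname{tww}(G(n,p)) \le C\, n\sqrt{p} \,\bigr] = 1.$$ That is, with high probability $\operatorname{tww}(G(n,p)) = \Theta(n\sqrt{p})$. -/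

import Mathlib

open Filter Topology

universe u

/-- A trigraph on the vertex type `V`: two disjoint sets of (unordered, loopless) edges,
the black edges and the red edges. -/
@[ext]
structure Trigraph (V : Type u) where
  black : SimpleGraph V
  red : SimpleGraph V
  disj : Disjoint black red

namespace Trigraph

variable {V : Type u}

/-- A graph, regarded as a trigraph without red edges. -/
def ofGraph (G : SimpleGraph V) : Trigraph V where
  black := G
  red := ⊥
  disj := disjoint_bot_right

/-- The graph of all edges (black or red) of a trigraph. -/
def edges (G : Trigraph V) : SimpleGraph V := G.black ⊔ G.red

/-- The red-degree of `v`: the number of red edges incident with `v`. -/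
noncomputable def redDegree (G : Trigraph V) (v : V) : ℕ := (G.red.neighborSet v).ncard

/-- Delete `u` and `v` from the graph `H` and add a new vertex `w` (represented by `none`) that is
adjacent to exactly those remaining vertices `x` with `P x`. -/
def replacePair (H : SimpleGraph V) (u v : V) (P : V → Prop) :
    SimpleGraph (Option {x : V // x ≠ u ∧ x ≠ v}) where
  Adj
    | some x, some y => H.Adj x y
    | none, some x => P x
    | some x, none => P x
    | none, none => False
  symm := ⟨by
    rintro (_ | x) (_ | y) h
    · exact h
    · exact h
    · exact h
    · exact H.adj_symm h⟩
  loopless := ⟨by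
    rintro (_ | x) h
    · exact h
    · exact H.irrefl h⟩

/-- The trigraph `G / {u, v}` obtained from `G` by contracting `u` and `v` to a new vertex `w`
(represented by `none`): nothing changes away from `w`; the edge `wx` is black if both `ux` and `vx`
are black, it is absent if neither `ux` nor `vx` is an edge, and it is red otherwise. -/
def contract (G : Trigraph V) (u v : V) : Trigraph (Option {x : V // x ≠ u ∧ x ≠ v}) where
  black := replacePair G.black u v fun x => G.black.Adj u x ∧ G.black.Adj v x
  red := replacePair G.red u v fun x =>
    ¬ (G.black.Adj u x ∧ G.black.Adj v x) ∧ ¬ (¬ G.edges.Adj u x ∧ ¬ G.edges.Adj v x)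
  disj := by
    rw [SimpleGraph.disjoint_left]
    rintro (_ | x) (_ | y) h h'
    · exact h
    · exact h'.1 h
    · exact h'.1 h
    · exact SimpleGraph.disjoint_left.1 G.disj _ _ h h'

/-- `HasContractionSeq d G`: there is a `d`-contraction sequence of `G`, that is, a sequence of
trigraphs that starts with `G`, ends with a one-vertex trigraph, in which each term but the first is
obtained from its predecessor by contracting two distinct vertices, and in which every vertex of
every term has red-degree at most `d`. -/
inductive HasContractionSeq (d : ℕ) : {V : Type u} → Trigraph V → Prop
  | single {V : Type u} (G : Trigraph V) (hd : ∀ x, G.redDegree x ≤ d) (h : Nat.card V = 1) :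
      HasContractionSeq d G
  | step {V : Type u} (G : Trigraph V) (hd : ∀ x, G.redDegree x ≤ d) (u v : V) (huv : u ≠ v)
      (h : HasContractionSeq d (G.contract u v)) : HasContractionSeq d G

theorem card_contract [Finite V] {u v : V} (huv : u ≠ v) :
    Nat.card (Option {x : V // x ≠ u ∧ x ≠ v}) + 1 = Nat.card V := by
  classical
  have := Fintype.ofFinite V
  have h1 : (({u, v} : Finset V)ᶜ).card + ({u, v} : Finset V).card = Fintype.card V :=
    Finset.card_compl_add_card _
  rw [Finset.card_pair huv] at h1
  rw [Finite.card_option, Nat.card_eq_fintype_card, Nat.card_eq_fintype_card,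
    Fintype.card_of_subtype ({u, v} : Finset V)ᶜ (by simp)]
  omega

/-- Every nonempty finite trigraph has a `d`-contraction sequence for some `d`. -/
theorem exists_hasContractionSeq [Finite V] [Nonempty V] (G : Trigraph V) :
    ∃ d, HasContractionSeq d G := by
  have red_le : ∀ {W : Type u} [Finite W] (H : Trigraph W) (x : W),
      H.redDegree x ≤ Nat.card W := fun H x => Set.ncard_le_card _
  have key : ∀ (N k : ℕ) (W : Type u) [Finite W] (H : Trigraph W),
      Nat.card W = k + 1 → k + 1 ≤ N → HasContractionSeq N H := by
    intro N k
    induction k with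
    | zero => exact fun W _ H hk hN => .single H (fun x => (red_le H x).trans (by omega)) hk
    | succ k ih =>
      intro W _ H hk hN
      have : Nontrivial W := Finite.one_lt_card_iff_nontrivial.1 (by omega)
      obtain ⟨u, v, huv⟩ := exists_pair_ne W
      refine .step H (fun x => (red_le H x).trans (by omega)) u v huv (ih _ _ ?_ (by omega))
      have := card_contract huv
      omega
  have hpos : 0 < Nat.card V := Nat.card_pos
  exact ⟨Nat.card V, key _ (Nat.card V - 1) V G (by omega) (by omega)⟩

end Trigraph

/-- The twin-width of a finite graph: the minimum `d` such that it has a `d`-contraction sequence.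
(The minimum is over a nonempty set as soon as the graph has a vertex.) -/
noncomputable def twinWidth {V : Type u} [Finite V] (G : SimpleGraph V) : ℕ :=
  sInf {d : ℕ | (Trigraph.ofGraph G).HasContractionSeq d}

/-!
Upper bound: group the vertices into about `n√p` blocks of size `s ≈ 1 / √p`, and contract each
block by absorbing its vertices one at a time. At every moment a vertex that has not been absorbed
has red edges only to blocks, hence at most `n√p` of them, while a part inside a block has red
degree at most `s` times the maximum degree of the graph. The latter is at most `6pn` with high
probability.

Lower bound: halt a contraction sequence as soon as half of the vertices lie in parts of size at
least `s`; about half of them then still lie in smaller parts. For a fixed partition of this kind,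
a big part `A` and a small part `B` fail to be joined by a red edge with probability at most
`exp (-p|A||B| / 2)`, independently for distinct pairs. If every red degree is at most `n√p / 64`,
then the red edges, each weighted by `ps|A|`, have small total weight. By a Chernoff bound for this
weighted sum, this has probability at most `exp (-pn² / 64)`, which beats a union bound over the at
most `n ^ n` partitions.
-/

open Finset MeasureTheory ProbabilityTheory

namespace Trigraph

section Quotient

variable {V : Type*} {W : Type u} {G : SimpleGraph V} {f : V → W} {a b : W}

/-- The fibres of `f` over `a` and `b` are mixed in `G` if they span both an edge and a non-edge:
these are the pairs of parts that become red edges. -/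
def Mixed (G : SimpleGraph V) (f : V → W) (a b : W) : Prop :=
  Relation.Map G.Adj f f a b ∧ Relation.Map Gᶜ.Adj f f a b

theorem map_adj_symm (h : Relation.Map G.Adj f f a b) : Relation.Map G.Adj f f b a :=
  let ⟨x, y, hxy, hx, hy⟩ := h
  ⟨y, x, hxy.symm, hy, hx⟩

theorem Mixed.symm (h : Mixed G f a b) : Mixed G f b a :=
  h.imp map_adj_symm map_adj_symm

/-- The trigraph obtained from `G` by contracting every fibre of `f` to one vertex. -/
def quotient (G : SimpleGraph V) (f : V → W) : Trigraph W where
  black :=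
    { Adj := fun a b => a ≠ b ∧ ¬ Relation.Map Gᶜ.Adj f f a b
      symm := ⟨fun _ _ h => ⟨h.1.symm, mt map_adj_symm h.2⟩⟩
      loopless := ⟨fun _ h => h.1 rfl⟩ }
  red :=
    { Adj := fun a b => a ≠ b ∧ Mixed G f a b
      symm := ⟨fun _ _ h => ⟨h.1.symm, h.2.symm⟩⟩
      loopless := ⟨fun _ h => h.1 rfl⟩ }
  disj := SimpleGraph.disjoint_left.2 fun _ _ hblack hred => hblack.2 hred.2.2

theorem quotient_black_adj :
    (quotient G f).black.Adj a b ↔ a ≠ b ∧ ¬ Relation.Map Gᶜ.Adj f f a b := Iff.rfl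

theorem quotient_red_adj : (quotient G f).red.Adj a b ↔ a ≠ b ∧ Mixed G f a b := Iff.rfl

theorem quotient_edges_adj (hf : Function.Surjective f) :
    (quotient G f).edges.Adj a b ↔ a ≠ b ∧ Relation.Map G.Adj f f a b := by
  have adj_or_not_adj (hab : a ≠ b) :
      Relation.Map G.Adj f f a b ∨ Relation.Map Gᶜ.Adj f f a b := by
    obtain ⟨x, rfl⟩ := hf a
    obtain ⟨y, rfl⟩ := hf b
    by_cases hxy : G.Adj x y
    · exact .inl ⟨x, y, hxy, rfl, rfl⟩
    · exact .inr ⟨x, y, (G.compl_adj x y).2 ⟨ne_of_apply_ne f hab, hxy⟩, rfl, rfl⟩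
  simp only [edges, SimpleGraph.sup_adj, quotient_black_adj, quotient_red_adj, Mixed]
  tauto

theorem quotient_id (G : SimpleGraph W) : quotient G id = ofGraph G := by
  ext a b
  · have : G.Adj a b → a ≠ b := SimpleGraph.Adj.ne
    simp only [quotient_black_adj, Relation.map_id_id, SimpleGraph.compl_adj, ofGraph]
    tauto
  · simp +contextual [quotient_red_adj, Mixed, ofGraph]

open Classical in
/-- The map that identifies `u` and `v`; its codomain is the vertex type of a contraction. -/
noncomputable def identify (u v : W) (x : W) : Option {x : W // x ≠ u ∧ x ≠ v} :=
  if h : x ≠ u ∧ x ≠ v then some ⟨x, h⟩ else none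

variable {u v x y : W}

theorem identify_eq_none : identify u v x = none ↔ x = u ∨ x = v := by
  simp only [identify, dite_eq_right_iff, reduceCtorEq, imp_false]
  tauto

theorem identify_eq_some {z : {x : W // x ≠ u ∧ x ≠ v}} : identify u v x = some z ↔ x = z := by
  simp only [identify, Option.dite_none_right_eq_some, Option.some.injEq, Subtype.ext_iff,
    exists_prop, and_iff_right_iff_imp]
  rintro rfl
  exact z.2

theorem identify_eq_identify :
    identify u v x = identify u v y ↔ x = y ∨ (x = u ∨ x = v) ∧ (y = u ∨ y = v) := by
  rcases h : identify u v y with _ | z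
  · rw [identify_eq_none] at h ⊢
    exact ⟨fun hx => .inr ⟨hx, h⟩, by rintro (rfl | hx); exacts [h, hx.1]⟩
  · rw [identify_eq_some] at h ⊢
    have := z.2
    grind

theorem identify_surjective (u v : W) : Function.Surjective (identify u v)
  | none => ⟨u, identify_eq_none.2 (.inl rfl)⟩
  | some y => ⟨y, identify_eq_some.2 rfl⟩

theorem map_identify_none_some (R : W → W → Prop) (z : {x : W // x ≠ u ∧ x ≠ v}) :
    Relation.Map R (identify u v) (identify u v) none (some z) ↔ R u z ∨ R v z := by
  simp only [Relation.Map, identify_eq_none, identify_eq_some]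
  aesop

theorem map_identify_some_some (R : W → W → Prop) (z w : {x : W // x ≠ u ∧ x ≠ v}) :
    Relation.Map R (identify u v) (identify u v) (some z) (some w) ↔ R z w := by
  simp only [Relation.Map, identify_eq_some]
  aesop

theorem contract_quotient (G : SimpleGraph V) (hf : Function.Surjective f) (u v : W) :
    (quotient G f).contract u v = quotient G (identify u v ∘ f) := by
  have black_none_some (z) : ((quotient G f).contract u v).black.Adj none (some z) ↔
      (quotient G (identify u v ∘ f)).black.Adj none (some z) := by
    simp only [contract, replacePair, quotient_black_adj, ← Relation.map_map,
      map_identify_none_some]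
    have := z.2
    grind
  have red_none_some (z) : ((quotient G f).contract u v).red.Adj none (some z) ↔
      (quotient G (identify u v ∘ f)).red.Adj none (some z) := by
    simp only [contract, replacePair, quotient_black_adj, quotient_red_adj, Mixed,
      quotient_edges_adj hf, ← Relation.map_map, map_identify_none_some]
    have := z.2
    grind
  ext (_ | z) (_ | w)
  · simp
  · exact black_none_some w
  · rw [SimpleGraph.adj_comm, black_none_some, SimpleGraph.adj_comm]
  · simp [contract, replacePair, quotient_black_adj, ← Relation.map_map, map_identify_some_some,
      Subtype.ext_iff]
  · simp
  · exact red_none_some w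
  · rw [SimpleGraph.adj_comm, red_none_some, SimpleGraph.adj_comm]
  · simp [contract, replacePair, quotient_red_adj, Mixed, ← Relation.map_map,
      map_identify_some_some, Subtype.ext_iff]

end Quotient

section UpperBound

theorem HasContractionSeq.redDegree_le {d : ℕ} {W : Type u} {T : Trigraph W}
    (h : HasContractionSeq d T) (a : W) : T.redDegree a ≤ d := by
  cases h with
  | single _ hd _ => exact hd a
  | step _ hd _ _ _ _ => exact hd a

theorem hasContractionSeq_of_card_le {d : ℕ} {W : Type u} [Finite W] [Nonempty W]
    (T : Trigraph W) (hd : Nat.card W ≤ d) : HasContractionSeq d T := by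
  have redDegree_le (x : W) : T.redDegree x ≤ d := (Set.ncard_le_card _).trans hd
  induction hk : Nat.card W generalizing W with
  | zero => exact absurd hk Nat.card_pos.ne'
  | succ k ih =>
    rcases subsingleton_or_nontrivial W with hW | hW
    · exact .single T redDegree_le (Nat.card_of_subsingleton (Classical.arbitrary W))
    · obtain ⟨u, v, huv⟩ := exists_pair_ne W
      have := card_contract huv
      exact .step T redDegree_le u v huv
        (ih _ (by omega) (fun x => (Set.ncard_le_card _).trans (by omega)) (by omega))

variable {V B : Type*} {W : Type u}

open Classical in
/-- The part indexed by `a` in the partition of `V` into the fibres of `f`. -/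
noncomputable def part [Fintype V] (f : V → W) (a : W) : Finset V := {x | f x = a}

theorem mem_part [Fintype V] {f : V → W} {a : W} {x : V} : x ∈ part f a ↔ f x = a := by
  simp [part]

theorem exists_card_part_le [Fintype V] {m s : ℕ} (h : Fintype.card V ≤ m * s) :
    ∃ ℓ : V → Fin m, ∀ b, #(part ℓ b) ≤ s := by
  obtain ⟨e⟩ : Nonempty (V ↪ Fin m × Fin s) :=
    Function.Embedding.nonempty_of_card_le (by simpa using h)
  refine ⟨fun x => (e x).1, fun b => ?_⟩
  calc #(part (fun x => (e x).1) b) ≤ #(univ : Finset (Fin s)) :=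
        card_le_card_of_injOn (fun x => (e x).2) (by simp) fun x hx y hy hxy =>
          e.injective (Prod.ext ((mem_part.1 hx).trans (mem_part.1 hy).symm) hxy)
    _ = s := by simp

theorem redDegree_quotient_le_card_part_mul [Fintype V] {G : SimpleGraph V} {Δ : ℕ}
    (hΔ : ∀ x, (G.neighborSet x).ncard ≤ Δ) (f : V → W) (a : W) :
    (quotient G f).redDegree a ≤ #(part f a) * Δ := by
  classical
  have hsub : (quotient G f).red.neighborSet a ⊆
      (((part f a).biUnion fun x => (G.neighborSet x).toFinset).image f : Finset W) := by
    rintro b ⟨-, ⟨x, y, hxy, rfl, rfl⟩, -⟩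
    exact mem_image_of_mem f (mem_biUnion.2 ⟨x, mem_part.2 rfl, by simpa using hxy⟩)
  calc (quotient G f).redDegree a
      ≤ #(((part f a).biUnion fun x => (G.neighborSet x).toFinset).image f) := by
        rw [← Set.ncard_coe_finset]
        exact Set.ncard_le_ncard hsub (finite_toSet _)
    _ ≤ #((part f a).biUnion fun x => (G.neighborSet x).toFinset) := card_image_le
    _ ≤ #(part f a) * Δ := card_biUnion_le_card_mul _ _ _ fun x _ => by
        rw [← Set.ncard_eq_toFinset_card']
        exact hΔ x

/-- The fibres of `f` are the blocks `ℓ ⁻¹' {b}`, except that the vertices of `T` have been taken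
out of their blocks and form singletons. The contraction sequence for the upper bound returns the
vertices of `T` to their blocks one at a time. -/
def IsBlockMap (ℓ : V → B) (T : Finset V) (f : V → W) : Prop :=
  ∀ x y, f x = f y ↔ x = y ∨ ℓ x = ℓ y ∧ x ∉ T ∧ y ∉ T

variable {ℓ : V → B} {T : Finset V} {f : V → W}

theorem IsBlockMap.card_part_le [Fintype V] (h : IsBlockMap ℓ T f) (v : V) :
    #(part f (f v)) ≤ #(part ℓ (ℓ v)) :=
  card_le_card fun x hx => mem_part.2 <| by
    rcases (h x v).1 (mem_part.1 hx) with rfl | hxv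
    exacts [rfl, hxv.1]

theorem IsBlockMap.redDegree_le_card_of_mem [Finite B] (h : IsBlockMap ℓ T f)
    (hf : Function.Surjective f) (G : SimpleGraph V) {v : V} (hv : v ∈ T) :
    (quotient G f).redDegree (f v) ≤ Nat.card B := by
  have singleton_of_mem {x y : V} (hy : y ∈ T) (hxy : f x = f y) : x = y :=
    ((h x y).1 hxy).resolve_right fun hxy => hxy.2.2 hy
  let g := Function.surjInv hf
  have notMem_of_red (b : W) (hb : (quotient G f).red.Adj (f v) b) : g b ∉ T := by
    intro hbT
    obtain ⟨-, ⟨x, y, hxy, hx, hy⟩, x', y', hxy', hx', hy'⟩ := hb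
    have hgb : f (g b) = b := Function.surjInv_eq hf b
    obtain rfl := singleton_of_mem hv hx
    obtain rfl := singleton_of_mem hv hx'
    obtain rfl := singleton_of_mem hbT (hy.trans hgb.symm)
    obtain rfl := singleton_of_mem hbT (hy'.trans hgb.symm)
    exact hxy'.2 hxy
  calc (quotient G f).redDegree (f v) ≤ (Set.univ : Set B).ncard := by
        refine Set.ncard_le_ncard_of_injOn (fun b => ℓ (g b)) (fun _ _ => trivial) ?_
        intro b hb b' hb' hbb
        have := (h (g b) (g b')).2 (.inr ⟨hbb, notMem_of_red b hb, notMem_of_red b' hb'⟩)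
        rwa [Function.surjInv_eq hf, Function.surjInv_eq hf] at this
    _ = Nat.card B := Set.ncard_univ B

theorem IsBlockMap.card_le [Finite B] (h : IsBlockMap ℓ ∅ f) (hf : Function.Surjective f) :
    Nat.card W ≤ Nat.card B := by
  refine Nat.card_le_card_of_injective (ℓ ∘ Function.surjInv hf) fun a b hab => ?_
  simpa [Function.surjInv_eq hf] using
    (h (Function.surjInv hf a) (Function.surjInv hf b)).2 (.inr ⟨hab, by simp, by simp⟩)

theorem IsBlockMap.of_insert [DecidableEq V] {v : V} (h : IsBlockMap ℓ (insert v T) f)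
    (hv : ∀ u ∉ insert v T, ℓ u ≠ ℓ v) : IsBlockMap ℓ T f := by
  intro x y
  rw [h x y]
  have := hv x
  have := hv y
  grind

theorem IsBlockMap.identify_of_insert [DecidableEq V] {u v : V}
    (h : IsBlockMap ℓ (insert v T) f) (hv : v ∉ T) (hu : u ∉ insert v T) (huv : ℓ u = ℓ v) :
    IsBlockMap ℓ T (identify (f u) (f v) ∘ f) := by
  intro x y
  simp only [Function.comp_apply, identify_eq_identify, h x y, h x u, h x v, h y u, h y v]
  grind

theorem IsBlockMap.hasContractionSeq [Fintype V] [Nonempty V] [Finite B] {G : SimpleGraph V}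
    {s Δ d : ℕ} (h : IsBlockMap ℓ T f) (hf : Function.Surjective f)
    (hs : ∀ b, #(part ℓ b) ≤ s) (hΔ : ∀ x, (G.neighborSet x).ncard ≤ Δ)
    (hB : Nat.card B ≤ d) (hd : s * Δ ≤ d) : HasContractionSeq d (quotient G f) := by
  classical
  induction T using Finset.induction_on generalizing W with
  | empty =>
    have : Finite W := Finite.of_surjective f hf
    have : Nonempty W := .map f inferInstance
    exact hasContractionSeq_of_card_le _ ((h.card_le hf).trans hB)
  | insert v T hv ih =>
    by_cases hu : ∃ u ∉ insert v T, ℓ u = ℓ v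
    · obtain ⟨u, hu, huv⟩ := hu
      refine .step _ (fun a => ?_) (f u) (f v) (by grind [h u v]) ?_
      · obtain ⟨x, rfl⟩ := hf a
        by_cases hx : x ∈ insert v T
        · exact (h.redDegree_le_card_of_mem hf G hx).trans hB
        · exact (redDegree_quotient_le_card_part_mul hΔ f _).trans
            ((Nat.mul_le_mul_right _ ((h.card_part_le x).trans (hs _))).trans hd)
      · rw [contract_quotient G hf]
        exact ih (h.identify_of_insert hv hu huv) ((identify_surjective _ _).comp hf)
    · push Not at hu
      exact ih (h.of_insert hu) hf

end UpperBound

end Trigraph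

theorem twinWidth_le_max {V : Type u} [Fintype V] [Nonempty V] {G : SimpleGraph V} {m s Δ : ℕ}
    (hcard : Fintype.card V ≤ m * s) (hΔ : ∀ x, (G.neighborSet x).ncard ≤ Δ) :
    twinWidth G ≤ max m (s * Δ) := by
  obtain ⟨ℓ, hℓ⟩ := Trigraph.exists_card_part_le hcard
  have : Trigraph.IsBlockMap ℓ univ (id : V → V) := fun x y => by simp
  refine Nat.sInf_le ?_
  rw [Set.mem_ofPred_eq, ← Trigraph.quotient_id]
  exact this.hasContractionSeq Function.surjective_id hℓ hΔ (by simp) (le_max_right _ _)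

namespace Trigraph

section BalancedPartition

variable {V : Type*} [Fintype V] {W : Type u} {G : SimpleGraph V} {f : V → W} {s : ℕ}

open Classical in
/-- The vertices lying in parts of size at least `s`. -/
noncomputable def bigVertices (s : ℕ) (f : V → W) : Finset V := {x | s ≤ #(part f (f x))}

theorem mem_bigVertices {x : V} : x ∈ bigVertices s f ↔ s ≤ #(part f (f x)) := by
  simp [bigVertices]

theorem bigVertices_id (hs : 2 ≤ s) : bigVertices s (id : V → V) = ∅ := by
  refine eq_empty_of_forall_notMem fun x hx => ?_
  have : part (id : V → V) x = {x} := by ext y; simp [mem_part]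
  rw [mem_bigVertices, id, this, card_singleton] at hx
  omega

theorem bigVertices_of_subsingleton [Subsingleton W] (hs : s ≤ Fintype.card V) :
    bigVertices s f = univ := by
  refine eq_univ_of_forall fun x => mem_bigVertices.2 ?_
  rwa [show part f (f x) = univ from
    eq_univ_of_forall fun y => mem_part.2 (Subsingleton.elim _ _), card_univ]

theorem bigVertices_comp_of_injective {W' : Type*} {i : W → W'} (hi : Function.Injective i) :
    bigVertices s (i ∘ f) = bigVertices s f := by
  have part_comp (x : V) : part (i ∘ f) ((i ∘ f) x) = part f (f x) := by
    ext y
    simp [mem_part, hi.eq_iff]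
  ext x
  simp only [mem_bigVertices, part_comp]

theorem card_part_sdiff_bigVertices_le [DecidableEq V] (s : ℕ) (f : V → W) (a : W) :
    #(part f a \ bigVertices s f) ≤ s := by
  rcases le_total #(part f a) s with h | h
  · exact (card_le_card sdiff_subset).trans h
  · rw [sdiff_eq_empty_iff_subset.2 fun x hx => ?_]
    · simp
    · rwa [mem_bigVertices, mem_part.1 hx]

theorem part_identify_of_ne {u v : W} {x : V} (hu : f x ≠ u) (hv : f x ≠ v) :
    part (identify u v ∘ f) (identify u v (f x)) = part f (f x) := by
  ext y
  simp only [mem_part, Function.comp_apply, identify_eq_identify]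
  tauto

theorem card_bigVertices_identify_le (s : ℕ) (f : V → W) (u v : W) :
    #(bigVertices s (identify u v ∘ f)) ≤ #(bigVertices s f) + 2 * s := by
  classical
  have hsub : bigVertices s (identify u v ∘ f) ⊆ bigVertices s f ∪
      (part f u \ bigVertices s f) ∪ (part f v \ bigVertices s f) := by
    intro x hx
    have (hu : f x ≠ u) (hv : f x ≠ v) : x ∈ bigVertices s f := by
      rwa [mem_bigVertices, ← part_identify_of_ne hu hv, ← Function.comp_apply (f := identify u v),
        ← mem_bigVertices]
    simp only [mem_union, Finset.mem_sdiff, mem_part]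
    tauto
  have hcard := card_le_card hsub
  have := card_union_le (bigVertices s f ∪ (part f u \ bigVertices s f))
    (part f v \ bigVertices s f)
  have := card_union_le (bigVertices s f) (part f u \ bigVertices s f)
  have := card_part_sdiff_bigVertices_le s f u
  have := card_part_sdiff_bigVertices_le s f v
  omega

omit [Fintype V] in
theorem redDegree_quotient_comp_le [Finite W] {W' : Type u} {i : W → W'} {d : ℕ}
    (hi : Function.Injective i) (h : ∀ a, (quotient G f).redDegree a ≤ d) (a : W') :
    (quotient G (i ∘ f)).redDegree a ≤ d := by
  by_cases ha : ∃ c, i c = a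
  · obtain ⟨c, rfl⟩ := ha
    refine le_trans ?_ (h c)
    rw [redDegree, redDegree, ← Set.ncard_image_of_injective _ hi]
    refine Set.ncard_le_ncard ?_ (Set.toFinite _)
    rintro b ⟨hcb, ⟨x, y, hxy, hx, rfl⟩, x', y', hxy', hx', hy'⟩
    exact ⟨f y, ⟨ne_of_apply_ne i hcb, ⟨x, y, hxy, hi hx, rfl⟩, x', y', hxy', hi hx', hi hy'⟩, rfl⟩
  · have : (quotient G (i ∘ f)).red.neighborSet a = ∅ :=
      Set.eq_empty_of_forall_notMem fun b ⟨_, ⟨x, _, _, hx, _⟩, _⟩ => ha ⟨f x, hx⟩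
    simp [redDegree, this]

theorem HasContractionSeq.exists_quotient_balanced {T : Trigraph W} {d : ℕ}
    (hT : HasContractionSeq d T) (hf : Function.Surjective f) (hTf : T = quotient G f)
    (hs : s ≤ Fintype.card V) (hbig : 2 * #(bigVertices s f) < Fintype.card V) :
    ∃ (W' : Type u) (g : V → W'), Function.Surjective g ∧
      (∀ a, (quotient G g).redDegree a ≤ d) ∧
      Fintype.card V ≤ 2 * #(bigVertices s g) ∧
      2 * #(bigVertices s g) ≤ Fintype.card V + 4 * s := by
  induction hT with
  | single T _ h =>
    have := (Nat.card_eq_one_iff_unique.1 h).1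
    rw [bigVertices_of_subsingleton hs, card_univ] at hbig
    omega
  | step T _ u v _ h ih =>
    subst hTf
    have hcontract := contract_quotient G hf u v
    by_cases hg : 2 * #(bigVertices s (identify u v ∘ f)) < Fintype.card V
    · exact ih ((identify_surjective u v).comp hf) hcontract hg
    · have := card_bigVertices_identify_le s f u v
      exact ⟨_, _, (identify_surjective u v).comp hf, hcontract ▸ h.redDegree_le,
        by omega, by omega⟩

theorem HasContractionSeq.exists_balanced {V : Type u} [Fintype V] {G : SimpleGraph V} {d : ℕ}
    (h : HasContractionSeq d (ofGraph G)) (hs : 2 ≤ s) (hsV : s ≤ Fintype.card V) :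
    ∃ f : V → V, (∀ a, (quotient G f).redDegree a ≤ d) ∧
      Fintype.card V ≤ 2 * #(bigVertices s f) ∧
      2 * #(bigVertices s f) ≤ Fintype.card V + 4 * s := by
  obtain ⟨W, g, hg, hd, hbig⟩ := h.exists_quotient_balanced Function.surjective_id
    (quotient_id G).symm hsV (by rw [bigVertices_id hs, card_empty]; omega)
  have : Finite W := Finite.of_surjective g hg
  have hi : Function.Injective (Function.surjInv hg) := Function.injective_surjInv hg
  refine ⟨Function.surjInv hg ∘ g, redDegree_quotient_comp_le hi hd, ?_⟩
  rwa [bigVertices_comp_of_injective hi]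

end BalancedPartition

end Trigraph

section Chernoff

variable {Ω ι κ : Type*} {mΩ : MeasurableSpace Ω} {μ : Measure Ω}

theorem iIndepFun_map_measure_of_comp {Ω' : Type*} {mΩ' : MeasurableSpace Ω'} {β : ι → Type*}
    {mβ : ∀ i, MeasurableSpace (β i)} {T : Ω → Ω'} {X : ∀ i, Ω' → β i} (hT : Measurable T)
    (hX : ∀ i, Measurable (X i)) (h : iIndepFun (fun i => X i ∘ T) μ) :
    iIndepFun X (μ.map T) := by
  refine iIndepFun_iff_measure_inter_preimage_eq_mul.2 fun S sets hsets => ?_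
  have hpre (i) (hi : i ∈ S) : MeasurableSet (X i ⁻¹' sets i) := hX i (hsets i hi)
  rw [Measure.map_apply hT (Finset.measurableSet_biInter S hpre), Set.preimage_iInter₂]
  exact (h.measure_inter_preimage_eq_mul S hsets).trans
    (prod_congr rfl fun i hi => (Measure.map_apply hT (hpre i hi)).symm)

theorem iIndepSet_of_pairwise_disjoint {m : ι → MeasurableSpace Ω} (hm : ∀ i, m i ≤ mΩ)
    (h : iIndep m μ) {E : κ → Set ι} (hE : Pairwise (Function.onFun Disjoint E)) {A : κ → Set Ω}
    (hA : ∀ k, MeasurableSet[⨆ i ∈ E k, m i] (A k)) : iIndepSet A μ := by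
  classical
  refine (iIndepSet_iff_meas_biInter fun k => iSup₂_le (fun i _ => hm i) _ (hA k)).2 fun K => ?_
  induction K using Finset.induction_on with
  | empty => have := h.isProbabilityMeasure; simp
  | insert a K ha ih =>
    have hdisj : Disjoint (E a) (⋃ k ∈ K, E k) :=
      Set.disjoint_iUnion₂_right.2 fun k hk => hE (ne_of_mem_of_not_mem hk ha).symm
    have hK : MeasurableSet[⨆ i ∈ ⋃ k ∈ K, E k, m i] (⋂ k ∈ K, A k) :=
      Finset.measurableSet_biInter K fun k hk =>
        (show ⨆ i ∈ E k, m i ≤ ⨆ i ∈ ⋃ k ∈ K, E k, m i from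
          biSup_mono fun i hi => Set.mem_biUnion hk hi) _ (hA k)
    rw [set_biInter_insert, prod_insert ha, ← ih]
    exact (Indep_iff _ _ _).1 (indep_iSup_of_disjoint hm h hdisj) _ _ (hA a) hK

variable [Fintype κ] {A : κ → Set Ω}

theorem mgf_sum_indicator (hA : iIndepSet A μ) (hAm : ∀ k, MeasurableSet (A k)) (l : κ → ℝ)
    (t : ℝ) : mgf (fun ω => ∑ k, (A k).indicator (fun _ => l k) ω) μ t =
      ∏ k, (1 + μ.real (A k) * (Real.exp (t * l k) - 1)) := by
  have := hA.isProbabilityMeasure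
  have hindep : iIndepFun (fun k => (A k).indicator fun _ => l k) μ := by
    convert hA.iIndepFun_indicator.comp (fun k (x : ℝ) => x * l k)
      (fun k => measurable_id.mul_const _) using 2 with k
    ext ω
    by_cases hω : ω ∈ A k <;> simp [hω]
  have hmgf (k) : mgf ((A k).indicator fun _ => l k) μ t =
      1 + μ.real (A k) * (Real.exp (t * l k) - 1) := by
    have hexp (ω) : Real.exp (t * (A k).indicator (fun _ => l k) ω) =
        1 + (A k).indicator (fun _ => Real.exp (t * l k) - 1) ω := by
      by_cases hω : ω ∈ A k <;> simp [hω]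
    simp_rw [mgf, hexp]
    rw [integral_add (integrable_const _) ((integrable_const _).indicator (hAm k)),
      integral_indicator_const _ (hAm k)]
    simp
  simp_rw [← hmgf]
  rw [← hindep.mgf_sum (fun k => measurable_const.indicator (hAm k))]
  simp only [← Finset.sum_apply]

theorem exp_neg_add_mul_le {y l q : ℝ} (hy : 0 ≤ y) (hl : y + Real.log 2 ≤ l)
    (hq : q ≤ Real.exp (-(2 * y))) :
    Real.exp (-l) + (1 - Real.exp (-l)) * q ≤ Real.exp (-y) := by
  have hyl : Real.exp (-l) ≤ Real.exp (-y) / 2 := by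
    calc Real.exp (-l) ≤ Real.exp (-y - Real.log 2) := Real.exp_le_exp.2 (by linarith)
      _ = Real.exp (-y) / 2 := by rw [Real.exp_sub, Real.exp_log two_pos]
  have hsq : Real.exp (-(2 * y)) = Real.exp (-y) * Real.exp (-y) := by
    rw [← Real.exp_add]
    ring_nf
  have hy1 : Real.exp (-y) ≤ 1 := Real.exp_le_one_iff.2 (by linarith)
  have hy0 := Real.exp_pos (-y)
  have hl0 := Real.exp_pos (-l)
  rw [hsq] at hq
  nlinarith [mul_le_mul_of_nonneg_left hq (by linarith : 0 ≤ 1 - Real.exp (-l)),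
    mul_nonneg (by linarith : 0 ≤ 1 - Real.exp (-y))
      (by nlinarith : 0 ≤ Real.exp (-y) - Real.exp (-l) * (1 + Real.exp (-y)))]

theorem measureReal_sum_indicator_le_le (hA : iIndepSet A μ) (hAm : ∀ k, MeasurableSet (A k))
    {l y : κ → ℝ} (hy : ∀ k, 0 ≤ y k) (hl : ∀ k, y k + Real.log 2 ≤ l k)
    (hcompl : ∀ k, μ.real (A k)ᶜ ≤ Real.exp (-(2 * y k))) (L : ℝ) :
    μ.real {ω | ∑ k, (A k).indicator (fun _ => l k) ω ≤ L} ≤ Real.exp (L - ∑ k, y k) := by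
  have := hA.isProbabilityMeasure
  have hl0 : ∀ k, 0 ≤ l k := fun k => by linarith [hy k, hl k, Real.log_nonneg one_le_two]
  have hint : Integrable
      (fun ω => Real.exp (-1 * ∑ k, (A k).indicator (fun _ => l k) ω)) μ := by
    refine .of_bound (C := 1) (Measurable.aestronglyMeasurable ?_) (.of_forall fun ω => ?_)
    · exact ((Finset.measurable_fun_sum _ fun k _ =>
        measurable_const.indicator (hAm k)).const_mul _).exp
    · rw [Real.norm_of_nonneg (Real.exp_nonneg _), Real.exp_le_one_iff]
      have : 0 ≤ ∑ k, (A k).indicator (fun _ => l k) ω :=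
        sum_nonneg fun k _ => Set.indicator_nonneg (fun _ _ => hl0 k) ω
      linarith
  calc μ.real {ω | ∑ k, (A k).indicator (fun _ => l k) ω ≤ L}
      ≤ Real.exp L * mgf (fun ω => ∑ k, (A k).indicator (fun _ => l k) ω) μ (-1) := by
        simpa using measure_le_le_exp_mul_mgf L (by norm_num : (-1 : ℝ) ≤ 0) hint
    _ ≤ Real.exp L * ∏ k, Real.exp (-y k) := by
        rw [mgf_sum_indicator hA hAm]
        refine mul_le_mul_of_nonneg_left (prod_le_prod (fun k _ => ?_) fun k _ => ?_)
          (Real.exp_nonneg _)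
        · nlinarith [Real.exp_pos (-1 * l k), measureReal_nonneg (μ := μ) (s := A k),
            measureReal_le_one (μ := μ) (s := A k)]
        · refine le_trans (le_of_eq ?_) (exp_neg_add_mul_le (hy k) (hl k) (hcompl k))
          rw [probReal_compl_eq_one_sub (hAm k), neg_one_mul]
          ring
    _ = Real.exp (L - ∑ k, y k) := by
        rw [← Real.exp_sum, ← Real.exp_add, sum_neg_distrib, sub_eq_add_neg]

end Chernoff

section RandomGraph

open SimpleGraph unitInterval

variable {V : Type*} [Countable V]

instance : MeasurableSingletonClass (SimpleGraph V) where
  measurableSet_singleton G := by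
    convert measurable_edgeSet (measurableSet_singleton G.edgeSet) using 1
    ext H
    simp

omit [Countable V] in
theorem measurable_mem_edgeSet (e : Sym2 V) : Measurable fun G : SimpleGraph V => e ∈ G.edgeSet :=
  measurable_set_iff.1 measurable_edgeSet e

omit [Countable V] in
theorem measurable_fromEdgeSet_ofPred :
    Measurable fun ω : Sym2 V → Prop => fromEdgeSet {e | ω e} :=
  measurable_fromEdgeSet.comp MeasurableEquiv.setOfPred.measurable

theorem binomialRandom_eq_map_infinitePi (p : I) :
    binomialRandom V p = Measure.map (fun ω : Sym2 V → Prop => fromEdgeSet {e | ω e})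
      (Measure.infinitePi fun e : Sym2 V => toNNReal p • Measure.dirac (e ∈ Sym2.diagSetᶜ) +
        toNNReal (σ p) • Measure.dirac False) := by
  rw [binomialRandom_eq_map, setBernoulli_eq_map]
  exact Measure.map_map measurable_fromEdgeSet MeasurableEquiv.setOfPred.measurable

theorem iIndepFun_mem_edgeSet (p : I) :
    iIndepFun (fun (e : Sym2 V) (G : SimpleGraph V) => e ∈ G.edgeSet) (binomialRandom V p) := by
  rw [binomialRandom_eq_map_infinitePi]
  refine iIndepFun_map_measure_of_comp measurable_fromEdgeSet_ofPred measurable_mem_edgeSet ?_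
  convert iIndepFun_infinitePi (X := fun (e : Sym2 V) (q : Prop) => q ∧ ¬ e.IsDiag)
    (fun e => .of_discrete) using 2 with e
  · ext ω
    simp
  · exact fun e => inferInstance

theorem iIndepSet_mem_edgeSet (p : I) :
    iIndepSet (fun e : Sym2 V => {G : SimpleGraph V | e ∈ G.edgeSet}) (binomialRandom V p) := by
  refine (iIndepSet_iff_meas_biInter fun e =>
    measurableSet_setOfPred.2 (measurable_mem_edgeSet e)).2 fun E => ?_
  simpa [Set.preimage] using (iIndepFun_mem_edgeSet p).measure_inter_preimage_eq_mul E
    (sets := fun _ => {True}) fun _ _ => .of_discrete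

theorem binomialRandom_real_mem_edgeSet (p : I) {e : Sym2 V} (he : ¬ e.IsDiag) :
    (binomialRandom V p).real {G | e ∈ G.edgeSet} = p := by
  have hpre : (fun ω : Sym2 V → Prop => fromEdgeSet {e | ω e}) ⁻¹' {G | e ∈ G.edgeSet} =
      (fun ω => ω e) ⁻¹' {True} := by
    ext ω
    simp [he]
  rw [binomialRandom_eq_map_infinitePi, map_measureReal_apply measurable_fromEdgeSet_ofPred
    (measurableSet_setOfPred.2 (measurable_mem_edgeSet e)), hpre,
    ← map_measureReal_apply (measurable_pi_apply e) .of_discrete, Measure.infinitePi_map_eval]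
  simp [measureReal_def, he]

theorem binomialRandom_real_mem_edgeSet_le (p : I) (e : Sym2 V) :
    (binomialRandom V p).real {G | e ∈ G.edgeSet} ≤ p := by
  by_cases he : e.IsDiag
  · have hempty : {G : SimpleGraph V | e ∈ G.edgeSet} = ∅ :=
      Set.eq_empty_of_forall_notMem fun G hG => G.not_isDiag_of_mem_edgeSet hG he
    rw [hempty, measureReal_empty]
    exact p.2.1
  · exact (binomialRandom_real_mem_edgeSet p he).le

theorem binomialRandom_real_notMem_edgeSet (p : I) {e : Sym2 V} (he : ¬ e.IsDiag) :
    (binomialRandom V p).real {G | e ∉ G.edgeSet} = 1 - p := by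
  rw [← binomialRandom_real_mem_edgeSet p he]
  exact probReal_compl_eq_one_sub (measurableSet_setOfPred.2 (measurable_mem_edgeSet e))

theorem binomialRandom_real_forall_mem_edgeSet (p : I) {E : Finset (Sym2 V)}
    (hE : ∀ e ∈ E, ¬ e.IsDiag) :
    (binomialRandom V p).real {G | ∀ e ∈ E, e ∈ G.edgeSet} = (p : ℝ) ^ #E := by
  have hset : {G : SimpleGraph V | ∀ e ∈ E, e ∈ G.edgeSet} = ⋂ e ∈ E, {G | e ∈ G.edgeSet} := by
    ext G
    simp
  rw [hset, measureReal_def, (iIndepSet_mem_edgeSet p).meas_biInter E, ENNReal.toReal_prod]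
  exact prod_eq_pow_card fun e he => binomialRandom_real_mem_edgeSet p (hE e he)

theorem binomialRandom_real_forall_notMem_edgeSet (p : I) {E : Finset (Sym2 V)}
    (hE : ∀ e ∈ E, ¬ e.IsDiag) :
    (binomialRandom V p).real {G | ∀ e ∈ E, e ∉ G.edgeSet} = (1 - p : ℝ) ^ #E := by
  have h := (iIndepFun_mem_edgeSet p).measure_inter_preimage_eq_mul E (sets := fun _ => {False})
    fun _ _ => .of_discrete
  have hset : {G : SimpleGraph V | ∀ e ∈ E, e ∉ G.edgeSet} =
      ⋂ e ∈ E, (fun G : SimpleGraph V => e ∈ G.edgeSet) ⁻¹' {False} := by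
    ext G
    simp
  rw [hset, measureReal_def, h, ENNReal.toReal_prod, prod_eq_pow_card fun e he => ?_]
  simpa [measureReal_def, Set.preimage] using binomialRandom_real_notMem_edgeSet p (hE e he)

theorem binomialRandom_real_homogeneous_le {p : I} (hp : (p : ℝ) ≤ 1 / 2) {E : Finset (Sym2 V)}
    (hE : ∀ e ∈ E, ¬ e.IsDiag) (hcard : 2 ≤ #E) :
    (binomialRandom V p).real {G | (∀ e ∈ E, e ∈ G.edgeSet) ∨ ∀ e ∈ E, e ∉ G.edgeSet} ≤
      Real.exp (-(p * #E / 2)) := by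
  have hp0 : (0 : ℝ) ≤ p := p.2.1
  obtain ⟨m, hm⟩ : ∃ m, #E = m + 1 := ⟨#E - 1, by omega⟩
  have hm1 : (1 : ℝ) ≤ m := by exact_mod_cast (by omega : 1 ≤ m)
  calc _ ≤ (binomialRandom V p).real {G | ∀ e ∈ E, e ∈ G.edgeSet} +
        (binomialRandom V p).real {G | ∀ e ∈ E, e ∉ G.edgeSet} := measureReal_union_le _ _
    _ = (p : ℝ) ^ (m + 1) + (1 - p : ℝ) ^ (m + 1) := by
      rw [binomialRandom_real_forall_mem_edgeSet p hE,
        binomialRandom_real_forall_notMem_edgeSet p hE, hm]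
    _ ≤ (1 - p : ℝ) ^ m := by
      have : (p : ℝ) ^ m ≤ (1 - p : ℝ) ^ m := pow_le_pow_left₀ hp0 (by linarith) m
      rw [pow_succ, pow_succ]
      nlinarith
    _ ≤ Real.exp (-p) ^ m := pow_le_pow_left₀ (by linarith) (Real.one_sub_le_exp_neg _) m
    _ ≤ Real.exp (-(p * #E / 2)) := by
      rw [← Real.exp_nat_mul, hm, Real.exp_le_exp]
      push_cast
      nlinarith

end RandomGraph

section MaxDegree

open SimpleGraph unitInterval

variable {V : Type*} [Fintype V]

theorem ncard_neighborSet_eq_sum_indicator (G : SimpleGraph V) (v : V) :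
    ((G.neighborSet v).ncard : ℝ) =
      ∑ x, {H : SimpleGraph V | s(v, x) ∈ H.edgeSet}.indicator (fun _ => 1) G := by
  classical
  have hset : G.neighborSet v = (univ.filter (G.Adj v) : Finset V) := by
    ext x
    simp
  rw [hset, Set.ncard_coe_finset, card_filter]
  push_cast
  exact sum_congr rfl fun x _ => by simp [Set.indicator_apply]

theorem mgf_ncard_neighborSet_le (p : I) (v : V) :
    mgf (fun G : SimpleGraph V => ((G.neighborSet v).ncard : ℝ)) (binomialRandom V p) 1 ≤
      Real.exp (2 * p * Fintype.card V) := by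
  have hindep : iIndepSet (fun x => {G : SimpleGraph V | s(v, x) ∈ G.edgeSet})
      (binomialRandom V p) :=
    (iIndepSet_mem_edgeSet p).precomp (g := fun x => s(v, x)) fun x y h => Sym2.congr_right.1 h
  have hfactor (x : V) : 1 + (binomialRandom V p).real {G | s(v, x) ∈ G.edgeSet} *
      (Real.exp (1 * 1) - 1) ≤ Real.exp (2 * p) := by
    rw [mul_one]
    nlinarith [binomialRandom_real_mem_edgeSet_le p s(v, x), Real.exp_one_lt_three,
      Real.add_one_le_exp (2 * p : ℝ),
      measureReal_nonneg (μ := binomialRandom V p) (s := {G | s(v, x) ∈ G.edgeSet})]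
  simp_rw [ncard_neighborSet_eq_sum_indicator]
  calc _ = ∏ x, (1 + (binomialRandom V p).real {G | s(v, x) ∈ G.edgeSet} *
        (Real.exp (1 * 1) - 1)) := mgf_sum_indicator hindep (fun _ => .of_discrete) _ _
    _ ≤ ∏ _x : V, Real.exp (2 * p) := prod_le_prod (fun x _ => by
        nlinarith [measureReal_nonneg (μ := binomialRandom V p) (s := {G | s(v, x) ∈ G.edgeSet}),
          Real.add_one_le_exp (1 * 1 : ℝ)]) fun x _ => hfactor x
    _ = Real.exp (2 * p * Fintype.card V) := by
        rw [prod_const, ← Real.exp_nat_mul, card_univ, mul_comm]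

theorem binomialRandom_real_lt_degree_le (p : I) (v : V) :
    (binomialRandom V p).real
      {G | 6 * (p : ℝ) * Fintype.card V < ((G.neighborSet v).ncard : ℝ)} ≤
      Real.exp (-(4 * p * Fintype.card V)) := by
  calc (binomialRandom V p).real
        {G | 6 * (p : ℝ) * Fintype.card V < ((G.neighborSet v).ncard : ℝ)}
      ≤ (binomialRandom V p).real
        {G | 6 * (p : ℝ) * Fintype.card V ≤ ((G.neighborSet v).ncard : ℝ)} :=
        measureReal_mono fun G hG => le_of_lt (α := ℝ) hG
    _ ≤ Real.exp (-1 * (6 * p * Fintype.card V)) * Real.exp (2 * p * Fintype.card V) :=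
        (measure_ge_le_exp_mul_mgf _ zero_le_one .of_finite).trans
          (mul_le_mul_of_nonneg_left (mgf_ncard_neighborSet_le p v) (Real.exp_nonneg _))
    _ = Real.exp (-(4 * p * Fintype.card V)) := by
        rw [← Real.exp_add]
        congr 1
        ring

theorem binomialRandom_real_exists_lt_degree_le (p : I) :
    (binomialRandom V p).real
      {G | ∃ v, 6 * (p : ℝ) * Fintype.card V < ((G.neighborSet v).ncard : ℝ)} ≤
      Fintype.card V * Real.exp (-(4 * p * Fintype.card V)) := by
  rw [Set.ofPred_exists]
  refine (measureReal_iUnion_fintype_le _).trans ?_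
  exact (sum_le_sum fun v _ => binomialRandom_real_lt_degree_le p v).trans (by simp)

end MaxDegree

namespace Trigraph

section CrossPairs

variable {V : Type*} [Fintype V] {W : Type u} {G : SimpleGraph V} {f : V → W} {a b : W}

open Classical in
/-- The pairs with one element in the fibre of `f` over `a` and the other in the fibre over `b`:
whether these two fibres are mixed depends only on which of these pairs are edges. -/
noncomputable def crossPairs (f : V → W) (a b : W) : Finset (Sym2 V) :=
  (part f a ×ˢ part f b).image fun q => s(q.1, q.2)

theorem mem_crossPairs {e : Sym2 V} :
    e ∈ crossPairs f a b ↔ ∃ x y, f x = a ∧ f y = b ∧ s(x, y) = e := by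
  simp [crossPairs, mem_part, and_assoc]

theorem not_isDiag_of_mem_crossPairs (hab : a ≠ b) {e : Sym2 V} (he : e ∈ crossPairs f a b) :
    ¬ e.IsDiag := by
  obtain ⟨x, y, rfl, rfl, rfl⟩ := mem_crossPairs.1 he
  exact mt (Sym2.mk_isDiag_iff.1) (ne_of_apply_ne f hab)

theorem card_crossPairs (hab : a ≠ b) : #(crossPairs f a b) = #(part f a) * #(part f b) := by
  classical
  rw [crossPairs, card_image_of_injOn, card_product]
  rintro ⟨x, y⟩ hxy ⟨x', y'⟩ hxy' heq
  simp only [coe_product, Set.mem_prod, mem_coe, mem_part] at hxy hxy'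
  rcases Sym2.eq_iff.1 heq with ⟨hx, hy⟩ | ⟨hx, -⟩
  · exact Prod.ext hx hy
  · exact absurd (hxy.1.symm.trans ((congrArg f hx).trans hxy'.2)) hab

theorem pairwise_disjoint_crossPairs (f : V → W) (P : W → Prop) :
    Pairwise (Function.onFun Disjoint fun k : {a // P a} × {b // ¬ P b} =>
      (crossPairs f k.1 k.2 : Set (Sym2 V))) := by
  rintro ⟨a, b⟩ ⟨a', b'⟩ hne
  refine Set.disjoint_left.2 fun e he he' => hne ?_
  obtain ⟨x, y, hx, hy, rfl⟩ := mem_crossPairs.1 he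
  obtain ⟨x', y', hx', hy', heq⟩ := mem_crossPairs.1 he'
  rcases Sym2.eq_iff.1 heq with ⟨rfl, rfl⟩ | ⟨rfl, rfl⟩
  · exact Prod.ext (Subtype.ext (hx.symm.trans hx')) (Subtype.ext (hy.symm.trans hy'))
  · exact absurd (hx'.symm.trans hy ▸ a'.2) b.2

theorem mixed_iff_exists_mem_crossPairs (hab : a ≠ b) :
    Mixed G f a b ↔
      (∃ e ∈ crossPairs f a b, e ∈ G.edgeSet) ∧ ∃ e ∈ crossPairs f a b, e ∉ G.edgeSet := by
  refine and_congr ⟨?_, ?_⟩ ⟨?_, ?_⟩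
  · rintro ⟨x, y, hxy, hx, hy⟩
    exact ⟨s(x, y), mem_crossPairs.2 ⟨x, y, hx, hy, rfl⟩, hxy⟩
  · rintro ⟨e, he, hxy⟩
    obtain ⟨x, y, hx, hy, rfl⟩ := mem_crossPairs.1 he
    exact ⟨x, y, hxy, hx, hy⟩
  · rintro ⟨x, y, hxy, hx, hy⟩
    exact ⟨s(x, y), mem_crossPairs.2 ⟨x, y, hx, hy, rfl⟩, hxy.2⟩
  · rintro ⟨e, he, hxy⟩
    obtain ⟨x, y, hx, hy, rfl⟩ := mem_crossPairs.1 he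
    exact ⟨x, y, ⟨ne_of_apply_ne f (hx ▸ hy ▸ hab), hxy⟩, hx, hy⟩

end CrossPairs

section FewMixedPairs

open SimpleGraph unitInterval

variable {V : Type*} [Fintype V] {W : Type u}

omit [Fintype V] in
theorem iIndepSet_mixed [Finite V] (p : I) (f : V → W) (P : W → Prop) :
    iIndepSet (fun k : {a // P a} × {b // ¬ P b} => {G : SimpleGraph V | Mixed G f k.1 k.2})
      (binomialRandom V p) := by
  have := Fintype.ofFinite V
  refine iIndepSet_of_pairwise_disjoint (fun e => (measurable_mem_edgeSet e).comap_le)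
    (iIndepFun_mem_edgeSet p) (pairwise_disjoint_crossPairs f P) fun ⟨a, b⟩ => ?_
  have hab : (a : W) ≠ b := fun h => b.2 (h ▸ a.2)
  have hedge (q : Prop) : ∀ e ∈ crossPairs f a b,
      MeasurableSet[⨆ e ∈ (crossPairs f a b : Set (Sym2 V)), MeasurableSpace.comap
        (fun G : SimpleGraph V => e ∈ G.edgeSet) ⊤] {G | (e ∈ G.edgeSet) = q} := fun e he =>
    le_iSup₂ (f := fun e (_ : e ∈ (crossPairs f a b : Set (Sym2 V))) => MeasurableSpace.comap
        (fun G : SimpleGraph V => e ∈ G.edgeSet) ⊤) e he _ ⟨{q}, trivial, rfl⟩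
  have hset : {G : SimpleGraph V | Mixed G f a b} =
      (⋃ e ∈ crossPairs f a b, {G | (e ∈ G.edgeSet) = True}) ∩
        ⋃ e ∈ crossPairs f a b, {G | (e ∈ G.edgeSet) = False} := by
    ext G
    simp [mixed_iff_exists_mem_crossPairs hab]
  rw [hset]
  exact (Finset.measurableSet_biUnion _ (hedge True)).inter
    (Finset.measurableSet_biUnion _ (hedge False))

theorem binomialRandom_real_not_mixed_le {p : I} (hp : (p : ℝ) ≤ 1 / 2) {f : V → W} {a b : W}
    (hab : a ≠ b) (ha : 2 ≤ #(part f a)) :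
    (binomialRandom V p).real {G | Mixed G f a b}ᶜ ≤
      Real.exp (-(p * (#(part f a) * #(part f b)) / 2)) := by
  obtain hb | hb := Nat.eq_zero_or_pos #(part f b)
  · simp [hb]
  have hset : {G : SimpleGraph V | Mixed G f a b}ᶜ =
      {G | (∀ e ∈ crossPairs f a b, e ∈ G.edgeSet) ∨ ∀ e ∈ crossPairs f a b, e ∉ G.edgeSet} := by
    ext G
    rw [Set.mem_compl_iff, Set.mem_ofPred_eq, mixed_iff_exists_mem_crossPairs hab, not_and_or]
    push Not
    exact or_comm
  have hcard := card_crossPairs (f := f) hab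
  have := binomialRandom_real_homogeneous_le hp
    (fun e he => not_isDiag_of_mem_crossPairs (f := f) hab he) (by rw [hcard]; nlinarith)
  rw [hset]
  rw [hcard] at this
  exact_mod_cast this

omit [Fintype V] in
theorem sum_indicator_mixed_le [Fintype W] {G : SimpleGraph V} {f : V → W} {d : ℕ}
    (hd : ∀ a, (quotient G f).redDegree a ≤ d) {P : W → Prop} [DecidablePred P] {l : W → ℝ}
    (hl : ∀ a, 0 ≤ l a) :
    ∑ k : {a // P a} × {b // ¬ P b}, {H | Mixed H f k.1 k.2}.indicator (fun _ => l k.1) G ≤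
      ∑ a : {a // P a}, d * l a := by
  classical
  rw [Fintype.sum_prod_type]
  refine sum_le_sum fun a _ => ?_
  have hcard : #{b : {b // ¬ P b} | Mixed G f a b} ≤ d := by
    refine le_trans ?_ (hd a)
    rw [← card_map (Function.Embedding.subtype _), ← Set.ncard_coe_finset]
    refine Set.ncard_le_ncard (fun b' hb => ?_) (Set.toFinite _)
    obtain ⟨⟨b, hbP⟩, hmixed, rfl⟩ := mem_map.1 (mem_coe.1 hb)
    exact ⟨fun h : a = b => hbP (h ▸ a.2), (mem_filter.1 hmixed).2⟩
  calc ∑ b : {b // ¬ P b}, {H | Mixed H f a b}.indicator (fun _ => l a) G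
      = #{b : {b // ¬ P b} | Mixed G f a b} * l a := by
        simp [Set.indicator_apply, ← sum_filter]
    _ ≤ d * l a := by gcongr; exact hl a

theorem sum_card_part_subtype [Fintype W] (f : V → W) (P : W → Prop) [DecidablePred P] :
    ∑ a : {a // P a}, #(part f a) = #{x | P (f x)} := by
  classical
  rw [← sum_subtype ({a | P a} : Finset W) (by simp) fun a => #(part f a)]
  convert sum_card_fiberwise_eq_card_filter univ ({a | P a} : Finset W) f using 2
  · exact congrArg card (by ext x; simp [mem_part])
  · ext x
    simp

theorem sum_card_part_big [Fintype W] (s : ℕ) (f : V → W) :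
    ∑ a : {a // s ≤ #(part f a)}, #(part f a) = #(bigVertices s f) := by
  rw [sum_card_part_subtype f fun a => s ≤ #(part f a)]
  exact congrArg card (by ext x; simp [mem_bigVertices])

theorem sum_card_part_small [Fintype W] (s : ℕ) (f : V → W) :
    (∑ b : {b // ¬ s ≤ #(part f b)}, #(part f b) : ℝ) =
      Fintype.card V - #(bigVertices s f) := by
  classical
  rw [eq_sub_iff_add_eq, ← card_compl_add_card (bigVertices s f)]
  push_cast
  congr 1
  norm_cast
  rw [sum_card_part_subtype f fun a => ¬ s ≤ #(part f a)]
  exact congrArg card (by ext x; simp [mem_bigVertices])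

theorem sum_card_part_big_mul_card_part_small [Fintype W] (s : ℕ) (f : V → W) :
    (∑ k : {a // s ≤ #(part f a)} × {b // ¬ s ≤ #(part f b)},
      #(part f k.1) * #(part f k.2) : ℝ) =
      #(bigVertices s f) * (Fintype.card V - #(bigVertices s f)) := by
  rw [← sum_card_part_small, ← sum_card_part_big, Nat.cast_sum, sum_mul_sum,
    Fintype.sum_prod_type]

theorem binomialRandom_real_forall_redDegree_le [Finite W] {p : I} (hp : (p : ℝ) ≤ 1 / 2)
    {s : ℕ} (hs : 2 ≤ s) (hps : 1 ≤ (p : ℝ) * (s * s)) (d : ℕ) (f : V → W) :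
    (binomialRandom V p).real {G | ∀ a, (quotient G f).redDegree a ≤ d} ≤
      Real.exp (-(p * #(bigVertices s f) *
        ((Fintype.card V - #(bigVertices s f)) / 4 - s * d))) := by
  have := Fintype.ofFinite W
  have hp0 : (0 : ℝ) ≤ p := p.2.1
  -- The weight `l a` must not depend on the small part, so that a bound on the red degree of `a`
  -- bounds the total weight at `a`; `s` is the worst size of a small part.
  let Pair := {a // s ≤ #(part f a)} × {b // ¬ s ≤ #(part f b)}
  let y (k : Pair) : ℝ := p * (#(part f k.1) * #(part f k.2)) / 4
  let l (a : W) : ℝ := p * (#(part f a) * s)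
  have hl : ∀ k, y k + Real.log 2 ≤ l k.1 := fun ⟨⟨a, ha⟩, b, hb⟩ => by
    have hy : (p : ℝ) * (#(part f a) * #(part f b)) ≤ p * (#(part f a) * s) := by
      gcongr
      exact (not_le.1 hb).le
    have hla : 1 ≤ (p : ℝ) * (#(part f a) * s) := hps.trans (by gcongr)
    change (p : ℝ) * (#(part f a) * #(part f b)) / 4 + Real.log 2 ≤ p * (#(part f a) * s)
    linarith [Real.log_two_lt_d9]
  have hcompl : ∀ k : Pair, (binomialRandom V p).real {G | Mixed G f k.1 k.2}ᶜ ≤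
      Real.exp (-(2 * y k)) := fun ⟨⟨a, ha⟩, b, hb⟩ => by
    have hab : a ≠ b := fun h => hb (h ▸ ha)
    refine (binomialRandom_real_not_mixed_le hp hab (hs.trans ha)).trans_eq ?_
    congr 1
    ring
  have hlsum : ∑ a : {a // s ≤ #(part f a)}, d * l a = p * #(bigVertices s f) * (s * d) := by
    rw [← sum_card_part_big, Nat.cast_sum, mul_sum, sum_mul]
    exact sum_congr rfl fun a _ => by ring
  have hysum : ∑ k, y k = p * (#(bigVertices s f) *
      (Fintype.card V - #(bigVertices s f))) / 4 := by
    rw [← sum_card_part_big_mul_card_part_small, mul_sum, sum_div]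
  calc _ ≤ (binomialRandom V p).real {G | ∑ k : Pair,
          {H | Mixed H f k.1 k.2}.indicator (fun _ => l k.1) G ≤
            ∑ a : {a // s ≤ #(part f a)}, d * l a} :=
        measureReal_mono fun G hG => sum_indicator_mixed_le hG fun a => by positivity
    _ ≤ Real.exp (∑ a : {a // s ≤ #(part f a)}, d * l a - ∑ k, y k) :=
        measureReal_sum_indicator_le_le (iIndepSet_mixed p f _) (fun _ => .of_discrete)
          (fun k => by positivity) hl hcompl _
    _ = _ := by
        rw [hlsum, hysum]
        congr 1
        ring

end FewMixedPairs

end Trigraph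

section TwinWidth

open SimpleGraph Trigraph unitInterval

theorem one_le_ceil_one_div_mul {q : ℝ} (hq : 0 < q) : 1 ≤ (⌈1 / q⌉₊ : ℝ) * q :=
  (div_le_iff₀ hq).1 (Nat.le_ceil _)

theorem ceil_one_div_mul_le_two {q : ℝ} (hq : 0 < q) (hq1 : q ≤ 1) : (⌈1 / q⌉₊ : ℝ) * q ≤ 2 := by
  have hceil := mul_le_mul_of_nonneg_right (Nat.ceil_lt_add_one (one_div_pos.2 hq).le).le hq.le
  rw [add_mul, one_div_mul_cancel hq.ne'] at hceil
  linarith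

theorem two_le_ceil_one_div {q : ℝ} (hq : 0 < q) (hq1 : q < 1) : 2 ≤ ⌈1 / q⌉₊ :=
  Nat.lt_ceil.2 (by simpa using one_lt_one_div hq hq1)

theorem hasContractionSeq_twinWidth {V : Type u} [Finite V] [Nonempty V] (G : SimpleGraph V) :
    (ofGraph G).HasContractionSeq (twinWidth G) :=
  Nat.sInf_mem (exists_hasContractionSeq (ofGraph G))

variable {V : Type u} [Fintype V]

theorem twinWidth_le_max_of_degree_le [Nonempty V] {G : SimpleGraph V} {q Δ : ℝ} (hq : 0 < q)
    (hq1 : q ≤ 1) (hΔ : ∀ v, ((G.neighborSet v).ncard : ℝ) ≤ Δ) :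
    (twinWidth G : ℝ) ≤ max (Fintype.card V * q + 1) (2 * Δ / q) := by
  have hΔ0 : 0 ≤ Δ := (Nat.cast_nonneg _).trans (hΔ (Classical.arbitrary V))
  have hs1 := one_le_ceil_one_div_mul hq
  have hcard : Fintype.card V ≤ ⌈Fintype.card V * q⌉₊ * ⌈1 / q⌉₊ := by
    have hm : (Fintype.card V : ℝ) * q ≤ ⌈Fintype.card V * q⌉₊ := Nat.le_ceil _
    have : (Fintype.card V : ℝ) ≤ ⌈Fintype.card V * q⌉₊ * ⌈1 / q⌉₊ := by
      calc (Fintype.card V : ℝ) ≤ Fintype.card V * (⌈1 / q⌉₊ * q) :=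
            le_mul_of_one_le_right (Nat.cast_nonneg _) hs1
        _ = Fintype.card V * q * ⌈1 / q⌉₊ := by ring
        _ ≤ _ := by gcongr
    exact_mod_cast this
  refine (Nat.cast_le.2 (twinWidth_le_max hcard fun v => Nat.le_floor (hΔ v))).trans ?_
  rw [Nat.cast_max]
  refine max_le_max (Nat.ceil_lt_add_one (by positivity)).le ?_
  rw [Nat.cast_mul, le_div_iff₀ hq]
  calc (⌈1 / q⌉₊ * ⌊Δ⌋₊ * q : ℝ) = ⌈1 / q⌉₊ * q * ⌊Δ⌋₊ := by ring
    _ ≤ 2 * Δ := mul_le_mul (ceil_one_div_mul_le_two hq hq1) (Nat.floor_le hΔ0)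
        (Nat.cast_nonneg _) zero_le_two

theorem card_sq_div_le_mul_of_balanced {n s d b : ℝ} (hs : 8 * s ≤ n) (hsd : s * d ≤ n / 32)
    (hn : 0 ≤ n) (hlb : n ≤ 2 * b) (hub : 2 * b ≤ n + 4 * s) :
    n ^ 2 / 64 ≤ b * ((n - b) / 4 - s * d) := by
  calc n ^ 2 / 64 = n / 2 * (n / 32) := by ring
    _ ≤ b * ((n - b) / 4 - s * d) :=
        mul_le_mul (by linarith) (by linarith) (by positivity) (by linarith)

theorem binomialRandom_real_twinWidth_le_le {p : I} (hp : (p : ℝ) ≤ 1 / 2) {s d : ℕ} (hs : 2 ≤ s)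
    (hps : 1 ≤ (p : ℝ) * (s * s)) (hsV : 8 * s ≤ Fintype.card V)
    (hsd : (s * d : ℝ) ≤ Fintype.card V / 32) :
    (binomialRandom V p).real {G | twinWidth G ≤ d} ≤
      (Fintype.card V : ℝ) ^ Fintype.card V * Real.exp (-(p * (Fintype.card V ^ 2 / 64))) := by
  classical
  have : Nonempty V := Fintype.card_pos_iff.1 (by omega)
  let balanced : Finset (V → V) := {f | Fintype.card V ≤ 2 * #(bigVertices s f) ∧
    2 * #(bigVertices s f) ≤ Fintype.card V + 4 * s}
  have hcard : (#balanced : ℝ) ≤ (Fintype.card V : ℝ) ^ Fintype.card V := by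
    exact_mod_cast (card_le_univ balanced).trans_eq Fintype.card_fun
  have hsub : {G : SimpleGraph V | twinWidth G ≤ d} ⊆
      ⋃ f ∈ balanced, {G | ∀ a, (quotient G f).redDegree a ≤ d} := fun G hG => by
    obtain ⟨f, hf, hbal⟩ := (hasContractionSeq_twinWidth G).exists_balanced hs (by omega)
    exact Set.mem_biUnion (by simpa [balanced] using hbal) fun a => (hf a).trans hG
  have hterm : ∀ f ∈ balanced,
      (binomialRandom V p).real {G | ∀ a, (quotient G f).redDegree a ≤ d} ≤
        Real.exp (-(p * (Fintype.card V ^ 2 / 64))) := fun f hf => by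
    refine (binomialRandom_real_forall_redDegree_le hp hs hps d f).trans
      (Real.exp_le_exp.2 (neg_le_neg ?_))
    rw [mul_assoc]
    obtain ⟨hlb, hub⟩ := (mem_filter.1 hf).2
    exact mul_le_mul_of_nonneg_left (card_sq_div_le_mul_of_balanced (by exact_mod_cast hsV) hsd
      (Nat.cast_nonneg _) (by exact_mod_cast hlb) (by exact_mod_cast hub)) p.2.1
  calc (binomialRandom V p).real {G | twinWidth G ≤ d}
      ≤ ∑ f ∈ balanced, (binomialRandom V p).real {G | ∀ a, (quotient G f).redDegree a ≤ d} :=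
        (measureReal_mono hsub (measure_ne_top _ _)).trans (measureReal_biUnion_finset_le _ _)
    _ ≤ #balanced * Real.exp (-(p * (Fintype.card V ^ 2 / 64))) := by
        simpa using sum_le_card_nsmul _ _ _ hterm
    _ ≤ _ := by gcongr

section LogDensity

variable {p : I}

theorem one_le_log_natCast {n : ℕ} (hn : 3 ≤ n) : 1 ≤ Real.log n := by
  have hn3 : (3 : ℝ) ≤ n := by exact_mod_cast hn
  exact (Real.le_log_iff_exp_le (by linarith)).2 (Real.exp_one_lt_three.le.trans hn3)

theorem sixteen_le_card_mul_sqrt {n : ℕ} {x : ℝ} (hn : 3 ≤ n) (hx : 128 * Real.log n ≤ x * n) :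
    16 ≤ n * √x := by
  have hn3 : (3 : ℝ) ≤ n := by exact_mod_cast hn
  have hx0 : 0 ≤ x := by
    by_contra! h
    nlinarith [one_le_log_natCast hn]
  refine nonneg_le_nonneg_of_sq_le_sq (by positivity) ?_
  calc (16 * 16 : ℝ) ≤ x * n * n := by nlinarith [one_le_log_natCast hn]
    _ = n * √x * (n * √x) := by
        rw [mul_mul_mul_comm, Real.mul_self_sqrt hx0]
        ring

theorem mul_exp_neg_le_one_div {n x : ℝ} (hn : 0 < n) (hx : 2 * Real.log n ≤ x) :
    n * Real.exp (-x) ≤ 1 / n := by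
  calc n * Real.exp (-x) ≤ Real.exp (Real.log n) * Real.exp (-(2 * Real.log n)) := by
        rw [Real.exp_log hn]
        gcongr
    _ = 1 / n := by
        rw [← Real.exp_add, show Real.log n + -(2 * Real.log n) = -Real.log n by ring,
          Real.exp_neg, Real.exp_log hn, one_div]

theorem pow_self_mul_exp_neg_le_one_div {n : ℕ} {x : ℝ} (hn : 1 ≤ n)
    (hx : 2 * (n * Real.log n) ≤ x) : (n : ℝ) ^ n * Real.exp (-x) ≤ 1 / n := by
  have hn1 : (1 : ℝ) ≤ n := by exact_mod_cast hn
  calc (n : ℝ) ^ n * Real.exp (-x) ≤ 1 / (n : ℝ) ^ n :=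
        mul_exp_neg_le_one_div (by positivity) (by rwa [Real.log_pow])
    _ ≤ 1 / n := by
        gcongr
        exact le_self_pow₀ hn1 (by omega)

theorem binomialRandom_real_lt_twinWidth_le (hV : 3 ≤ Fintype.card V)
    (hp : 128 * Real.log (Fintype.card V) ≤ p * Fintype.card V) :
    (binomialRandom V p).real {G | 12 * (Fintype.card V * √(p : ℝ)) < (twinWidth G : ℝ)} ≤
      1 / Fintype.card V := by
  have : Nonempty V := Fintype.card_pos_iff.1 (by omega)
  have hcq := sixteen_le_card_mul_sqrt hV hp
  have hq : 0 < √(p : ℝ) := pos_of_mul_pos_right (by linarith) (Nat.cast_nonneg (Fintype.card V))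
  have hsub : {G : SimpleGraph V | 12 * (Fintype.card V * √(p : ℝ)) < (twinWidth G : ℝ)} ⊆
      {G | ∃ v, 6 * (p : ℝ) * Fintype.card V < ((G.neighborSet v).ncard : ℝ)} := fun G hG => by
    by_contra hdeg
    rw [Set.mem_ofPred_eq] at hG hdeg
    push Not at hdeg
    have htww := twinWidth_le_max_of_degree_le hq (Real.sqrt_le_one.2 p.2.2) hdeg
    rw [show 2 * (6 * (p : ℝ) * Fintype.card V) / √p = 12 * (Fintype.card V * (p / √p)) by ring,
      Real.div_sqrt] at htww
    exact absurd (htww.trans (max_le (by linarith) le_rfl)) hG.not_ge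
  refine (measureReal_mono hsub).trans ((binomialRandom_real_exists_lt_degree_le p).trans ?_)
  have hlog := one_le_log_natCast hV
  exact mul_exp_neg_le_one_div (by positivity) (by linarith)

theorem binomialRandom_real_twinWidth_lt_le (hV : 3 ≤ Fintype.card V)
    (hp : 128 * Real.log (Fintype.card V) ≤ p * Fintype.card V) (hp2 : (p : ℝ) ≤ 1 / 2) :
    (binomialRandom V p).real {G | (twinWidth G : ℝ) < 1 / 64 * (Fintype.card V * √(p : ℝ))} ≤
      1 / Fintype.card V := by
  have hcq := sixteen_le_card_mul_sqrt hV hp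
  have hq : 0 < √(p : ℝ) := pos_of_mul_pos_right (by linarith) (Nat.cast_nonneg (Fintype.card V))
  have hqq : √(p : ℝ) * √p = p := Real.mul_self_sqrt p.2.1
  have hq1 : √(p : ℝ) < 1 := by nlinarith
  have hs1 := one_le_ceil_one_div_mul hq
  have hs2 := ceil_one_div_mul_le_two hq hq1.le
  set s := ⌈1 / √(p : ℝ)⌉₊
  set d := ⌊1 / 64 * (Fintype.card V * √(p : ℝ))⌋₊
  have hps : 1 ≤ (p : ℝ) * (s * s) := by
    rw [← hqq]
    nlinarith
  have hsV : 8 * s ≤ Fintype.card V := by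
    have : (8 * s : ℝ) ≤ Fintype.card V := by
      refine le_of_mul_le_mul_right ?_ hq
      linarith
    exact_mod_cast this
  have hsd : (s * d : ℝ) ≤ Fintype.card V / 32 := by
    calc (s * d : ℝ) ≤ s * (1 / 64 * (Fintype.card V * √(p : ℝ))) := by
          gcongr
          exact Nat.floor_le (by positivity)
      _ = s * √(p : ℝ) * (Fintype.card V / 64) := by ring
      _ ≤ 2 * (Fintype.card V / 64) := by gcongr
      _ = _ := by ring
  calc _ ≤ (binomialRandom V p).real {G | twinWidth G ≤ d} :=
        measureReal_mono fun G hG => Nat.le_floor (le_of_lt (α := ℝ) hG)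
    _ ≤ (Fintype.card V : ℝ) ^ Fintype.card V * Real.exp (-(p * (Fintype.card V ^ 2 / 64))) :=
        binomialRandom_real_twinWidth_le_le hp2 (two_le_ceil_one_div hq hq1) hps hsV hsd
    _ ≤ 1 / Fintype.card V := by
        refine pow_self_mul_exp_neg_le_one_div (by omega) ?_
        nlinarith [mul_le_mul_of_nonneg_left hp (Nat.cast_nonneg (α := ℝ) (Fintype.card V))]

theorem one_sub_le_binomialRandom_real_twinWidth (hV : 3 ≤ Fintype.card V)
    (hp : 128 * Real.log (Fintype.card V) ≤ p * Fintype.card V) (hp2 : (p : ℝ) ≤ 1 / 2) :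
    1 - 2 / Fintype.card V ≤ (binomialRandom V p).real
      {G | 1 / 64 * (Fintype.card V * √(p : ℝ)) ≤ (twinWidth G : ℝ) ∧
        (twinWidth G : ℝ) ≤ 12 * (Fintype.card V * √(p : ℝ))} := by
  set bounds := {G : SimpleGraph V | 1 / 64 * (Fintype.card V * √(p : ℝ)) ≤ (twinWidth G : ℝ) ∧
    (twinWidth G : ℝ) ≤ 12 * (Fintype.card V * √(p : ℝ))}
  have hcompl : boundsᶜ ⊆
      {G | (twinWidth G : ℝ) < 1 / 64 * (Fintype.card V * √(p : ℝ))} ∪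
        {G | 12 * (Fintype.card V * √(p : ℝ)) < (twinWidth G : ℝ)} := fun G hG =>
    (not_and_or.1 hG).imp not_le.1 not_le.1
  have hle : (binomialRandom V p).real boundsᶜ ≤ 1 / Fintype.card V + 1 / Fintype.card V :=
    (measureReal_mono hcompl).trans <| (measureReal_union_le _ _).trans <|
      add_le_add (binomialRandom_real_twinWidth_lt_le hV hp hp2)
        (binomialRandom_real_lt_twinWidth_le hV hp)
  rw [probReal_compl_eq_one_sub .of_discrete, ← add_div, one_add_one_eq_two] at hle
  linarith

end LogDensity

end TwinWidth

theorem mainTheorem2_general {p : ℕ → unitInterval}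
    (hp : ∀ᶠ n : ℕ in atTop,
      128 * Real.log (n : ℝ) / (n : ℝ) ≤ (p n : ℝ) ∧ (p n : ℝ) ≤ 1 / 2) :
    Tendsto
      (fun n : ℕ => (SimpleGraph.binomialRandom (Fin n) (p n)).real
        {G : SimpleGraph (Fin n) |
          1 / 64 * ((n : ℝ) * √(p n : ℝ)) ≤ (twinWidth G : ℝ) ∧
          (twinWidth G : ℝ) ≤ 12 * ((n : ℝ) * √(p n : ℝ))})
      atTop (𝓝 1) := by
  have hlim : Tendsto (fun n : ℕ => 1 - 2 / (n : ℝ)) atTop (𝓝 1) := by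
    simpa using (tendsto_const_div_atTop_nhds_zero_nat (2 : ℝ)).const_sub 1
  refine tendsto_of_tendsto_of_tendsto_of_le_of_le' hlim tendsto_const_nhds ?_
    (.of_forall fun n => measureReal_le_one)
  filter_upwards [hp, eventually_ge_atTop 3] with n ⟨hlog, hhalf⟩ hn
  rw [div_le_iff₀ (by positivity)] at hlog
  simpa only [Fintype.card_fin] using one_sub_le_binomialRandom_real_twinWidth
    (V := Fin n) (by simpa using hn) (by simpa using hlog) hhalf

theorem mainTheorem2 :
    ∃ c C : ℝ, 0 < c ∧ 0 < C ∧
      ∀ p : ℕ → unitInterval,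
        (∀ᶠ n : ℕ in atTop,
          726 * Real.log (n : ℝ) / (n : ℝ) ≤ (p n : ℝ) ∧ (p n : ℝ) ≤ 1 / 2) →
        Tendsto
          (fun n : ℕ => (SimpleGraph.binomialRandom (Fin n) (p n)).real
            {G : SimpleGraph (Fin n) |
              c * ((n : ℝ) * √(p n : ℝ)) ≤ (twinWidth G : ℝ) ∧
              (twinWidth G : ℝ) ≤ C * ((n : ℝ) * √(p n : ℝ))})
          atTop (𝓝 1) :=
  ⟨1 / 64, 12, by norm_num, by norm_num, fun _ hp => mainTheorem2_general <| hp.mono fun n hn =>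
    ⟨le_trans (by have := Real.log_natCast_nonneg n; gcongr; norm_num) hn.1, hn.2⟩⟩
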